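/- \textbf{Proposition (the set of sequential equilibria is compact).} \emph{The game.} Time is $\tau=0,1,2,\dots$. There is a countable set $N$ of players containing nature ($0$); in each period $\tau$ a single player $N(\tau)$ is active, $N(\tau)=0$ if and only if $\tau=0$, and every player is active in some period. The players other than nature are called proper. For each $\tau\ge 1$ there are Polish spaces $A_\tau$ (actions) and $S_\tau$ (signals); nature chooses an element of a Polish space $A_0=:S_0$ with law $\nu=:\mu_0$. Write $H_\tau=\prod_{t<\tau}S_t\times\prod_{1\le t<\tau}A_t$ for histories, $H^p_\tau=\prod_{t<\tau,\,N(t)=N(\tau)}(S_t\times A_t)$ for private histories of the active player, and $P=\prod_{t\ge0}S_t\times\prod_{t\ge1}A_t$ for plays. For each $\tau\ge1$: (i) there is a measurable signal function $\sigma_\tau:H_\tau\to\Delta(S_\tau)$, and there are fixed $\mu_\tau\in\Delta(S_\tau)$, a measurable $g_\tau:H_\tau\times S_\tau\to\mathbb R$ that is jointly continuous in the action coordinates for fixed signals, and a nonnegative measurable $\mu_\tau$-integrable $f_\tau:S_\tau\to\mathbb{R}$ such that $\sigma_\tau(h,E)=\int_E g_\tau(h,s)\,d\mu_\tau(s)$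 and $g_\tau(h,s)\le f_\tau(s)$ for all $h\in H_\tau$, $s\in S_\tau$ and all measurable $E\subseteq S_\tau$; (ii) there is a measurable action correspondence $\mathcal A_\tau:H^p_\tau\times S_\tau\to 2^{A_\tau}$ with nonempty compact values which, for fixed signals, is upper and lower hemicontinuous jointly in the action coordinates. Each proper player $i$ has a bounded measurable payoff function $v_i:P\to\mathbb R$ that, for fixed signals, is jointly continuous in all action coordinates. \emph{Strategies and strategic measures.} A strategy of a proper player $i$ consists of measurable maps $\beta_\tau:H^p_\tau\times S_\tau\to\Delta(A_\tau)$, for each $\tau$ with $N(\tau)=i$, such that $\beta_\tau(h,s)(\mathcal A_\tau(h,s))=1$ for all $(h,s)$. A strategy profile induces, together with $\nu$ and the $\sigma_\tau$, a distribution on $P$. The strategic measure of a strategy of $i$ is the Borel probability measure on $\prod_{N(\tau)=i}S_\tau\times A_\tau$ under which, recursively, the signal in period $\tau$ has law $\mu_\tau$ and is independent of $i$'s previous signals and actions, and the action in period $\tau$ is then drawn from $\beta_\tau$. Let $M_i$ be the set of strategic measures of $i$, and let $M_0=\{\nu\}$. A profile $m=(m_i)_{i\in N}\in\prod_i M_i$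 determines the distribution on plays induced by any strategies whose strategic measures are the $m_i$. For $N(\tau)=i$, a $\tau$-continuation of $m_i\in M_i$ is an $m_i'\in M_i$ with the same marginal on $\prod_{N(t)=i,\,t<\tau}S_t\times A_t$. \emph{Sequential equilibrium.} Let $i$ be a proper player active at $\tau$. A measurable set $F\subseteq H^p_\tau\times S_\tau$ is strategically relevant at $\tau$ for $i$ if it is reached with positive probability under some strategy profile and if, for every fixed vector of signals, the section of $F$ in the action coordinates is open. If $F$ is strategically relevant at $\tau$ for $i$ and reached with positive probability under $m$, then $m_i$ is $\epsilon$-optimal at $F$ against $m_{-i}$ if, for every $\tau$-continuation $m_i'$ of $m_i$, $i$'s conditional expected payoff given $F$ under $(m_i,m_{-i})$ is higher than that under $(m_i',m_{-i})$ minus $\epsilon$. A profile $m\in\prod_iM_i$ is a sequential equilibrium if it is the limit of a sequence $(m^n)$ in $\prod_i M_i$ such that under each $m^n$ every strategically relevant set is reached with positive probability and such that, for every $\epsilon>0$, for all but finitely many $n$, for every proper player $i$, every period $\tau$ with $N(\tau)=i$ and every $F$ strategically relevant at $\tau$ for $i$, $m^n_i$ is $\epsilon$-optimal at $F$ against $m^n_{-i}$.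 Here each $M_i$ carries the weak topology (weak convergence of probability measures) and profiles carry the product topology. \emph{Claim.} The set of sequential equilibria is compact. -/

import Mathlib

open MeasureTheory ProbabilityTheory Filter Topology

noncomputable section

/-! Multistage games with signals. Time is `0, 1, 2, …`. Nature moves in period `0` only. Nature's
move space `A₀` is treated as a signal space, `A₀ = S₀`; accordingly `S 0` is the space of nature's
moves, `μ 0` is the law `ν` of nature's move, and the slot `A 0` is a one-point placeholder, so that
`∀ t, S t × A t` is the product of all `S t` (`t ≥ 0`) and all `A t` (`t ≥ 1`). -/

namespace SeqGame

/-- Plays: `∏_{t ≥ 0} S_t × ∏_{t ≥ 1} A_t`. -/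
abbrev Play (S A : ℕ → Type*) := ∀ t : ℕ, S t × A t

/-- Histories until period `τ`. -/
abbrev Hist (S A : ℕ → Type*) (τ : ℕ) := ∀ t : {t : ℕ // t < τ}, S t × A t

/-- Private histories of the player active at `τ`: the past signals and actions of that player. -/
abbrev PrivHist {Player : Type*} (N : ℕ → Player) (S A : ℕ → Type*) (τ : ℕ) :=
  ∀ t : {t : ℕ // t < τ ∧ N t = N τ}, S t × A t

/-- Information sets at `τ`: a private history together with the current signal. -/
abbrev Info {Player : Type*} (N : ℕ → Player) (S A : ℕ → Type*) (τ : ℕ) :=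
  PrivHist N S A τ × S τ

/-- The space `∏_{N(t) = i} S_t × A_t` on which the strategic measures of player `i` live. -/
abbrev OwnPath {Player : Type*} (N : ℕ → Player) (S A : ℕ → Type*) (i : Player) :=
  ∀ t : {t : ℕ // N t = i}, S t × A t

/-- The private history at `τ` contained in a full history until `τ`. -/
def histToPriv {Player : Type*} (N : ℕ → Player) (S A : ℕ → Type*) (τ : ℕ)
    (h : Hist S A τ) : PrivHist N S A τ :=
  fun t => h ⟨t, t.2.1⟩

/-- The information set at `τ` that a play passes through. -/
def playToInfo {Player : Type*} (N : ℕ → Player) (S A : ℕ → Type*) (τ : ℕ)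
    (p : Play S A) : Info N S A τ :=
  (fun t => p t, (p τ).1)

/-- Projection of `∏_{N(t) = i} S_t × A_t` onto the coordinates before `τ`, where `N(τ) = i`. -/
def ownPast {Player : Type*} (N : ℕ → Player) (S A : ℕ → Type*) {i : Player} {τ : ℕ}
    (hτ : N τ = i) (x : OwnPath N S A i) : PrivHist N S A τ :=
  fun t => x ⟨t, t.2.2.trans hτ⟩

/-- A segment of a play over the periods `0, …, n`, read as a history until `n + 1`. -/
def segToHist (S A : ℕ → Type*) (n : ℕ) (x : ∀ t : Finset.Iic n, S t × A t) : Hist S A (n + 1) :=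
  fun t => x ⟨t, Finset.mem_Iic.2 (Nat.lt_succ_iff.1 t.2)⟩

/-- The empty history. -/
def emptyHist (S A : ℕ → Type*) : Hist S A 0 := fun t => (Nat.not_lt_zero _ t.2).elim

section Measurability

variable {Player : Type*} (N : ℕ → Player) (S A : ℕ → Type*)
  [∀ t, MeasurableSpace (S t)] [∀ t, MeasurableSpace (A t)]

theorem measurable_histToPriv (τ : ℕ) : Measurable (histToPriv N S A τ) :=
  measurable_pi_lambda _ fun _ => measurable_pi_apply _

theorem measurable_segToHist (n : ℕ) : Measurable (segToHist S A n) :=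
  measurable_pi_lambda _ fun _ => measurable_pi_apply _

end Measurability

/-- A game of the class under consideration, together with the underlying signal
distributions `μ τ`. -/
structure Game (Player : Type*) (S A : ℕ → Type*)
    [∀ t, TopologicalSpace (S t)] [∀ t, MeasurableSpace (S t)]
    [∀ t, TopologicalSpace (A t)] [∀ t, MeasurableSpace (A t)] where
  /-- player `0` -/
  nature : Player
  /-- the player active at each period -/
  N : ℕ → Player
  N_eq_nature_iff : ∀ τ, N τ = nature ↔ τ = 0
  N_surjective : Function.Surjective N
  /-- `A 0` is a placeholder: nature's move is recorded in `S 0` -/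
  subsingleton_A_zero : Subsingleton (A 0)
  /-- underlying signal distributions; `μ 0 = ν` is the law of nature's move -/
  μ : ∀ τ, ProbabilityMeasure (S τ)
  /-- signal functions `σ_τ : H_τ → Δ(S_τ)` -/
  signal : ∀ τ, Kernel (Hist S A τ) (S τ)
  signal_markov : ∀ τ, IsMarkovKernel (signal τ)
  signal_zero : ∀ h, signal 0 h = μ 0
  /-- the signal functions have integrably bounded densities with respect to `μ τ` that are
  continuous in the past actions -/
  signal_density : ∀ τ, τ ≠ 0 → ∃ (g : Hist S A τ × S τ → ℝ) (f : S τ → ℝ),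
    Measurable g ∧
    (∀ (s : ∀ t : {t : ℕ // t < τ}, S t) (s' : S τ),
      Continuous fun a : (∀ t : {t : ℕ // t < τ}, A t) => g (fun t => (s t, a t), s')) ∧
    (∀ h E, MeasurableSet E → (signal τ h).real E = ∫ s in E, g (h, s) ∂(μ τ : Measure (S τ))) ∧
    Measurable f ∧ (∀ s, 0 ≤ f s) ∧ Integrable f (μ τ : Measure (S τ)) ∧
    ∀ h s, g (h, s) ≤ f s
  /-- action correspondences -/
  actions : ∀ τ, Info N S A τ → Set (A τ)
  actions_nonempty : ∀ τ x, (actions τ x).Nonempty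
  actions_compact : ∀ τ x, IsCompact (actions τ x)
  actions_measurable : ∀ τ (C : Set (A τ)), IsClosed C →
    MeasurableSet {x | (actions τ x ∩ C).Nonempty}
  actions_upper : ∀ τ (s : ∀ t : {t : ℕ // t < τ ∧ N t = N τ}, S t) (s' : S τ),
    UpperHemicontinuous fun a : (∀ t : {t : ℕ // t < τ ∧ N t = N τ}, A t) =>
      actions τ (fun t => (s t, a t), s')
  actions_lower : ∀ τ (s : ∀ t : {t : ℕ // t < τ ∧ N t = N τ}, S t) (s' : S τ),
    LowerHemicontinuous fun a : (∀ t : {t : ℕ // t < τ ∧ N t = N τ}, A t) =>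
      actions τ (fun t => (s t, a t), s')
  /-- payoff functions; only those of proper players matter -/
  payoff : Player → Play S A → ℝ
  payoff_bounded : ∀ i, i ≠ nature → ∃ C, ∀ p, |payoff i p| ≤ C
  payoff_measurable : ∀ i, i ≠ nature → Measurable (payoff i)
  payoff_continuous : ∀ i, i ≠ nature → ∀ s : (∀ t, S t),
    Continuous fun a : (∀ t, A t) => payoff i fun t => (s t, a t)

attribute [instance] Game.signal_markov

variable {Player : Type*} {S A : ℕ → Type*}
  [∀ t, TopologicalSpace (S t)] [∀ t, MeasurableSpace (S t)]
  [∀ t, TopologicalSpace (A t)] [∀ t, MeasurableSpace (A t)]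

/-- A strategy of player `i`: a feasible behaviour at each period at which `i` is active. (Nature
has exactly one strategy, the trivial one with values in the one-point space `A 0`.) -/
structure Strategy (G : Game Player S A) (i : Player) where
  kernel : ∀ τ, G.N τ = i → Kernel (Info G.N S A τ) (A τ)
  markov : ∀ τ hτ, IsMarkovKernel (kernel τ hτ)
  feasible : ∀ τ hτ x, kernel τ hτ x (G.actions τ x) = 1

attribute [instance] Strategy.markov

/-- A strategy profile. -/
abbrev Profile (G : Game Player S A) := ∀ i, Strategy G i

/-- The joint law of the signal and the action in period `τ` given the history until `τ`. -/
def stepKernel (G : Game Player S A) (β : Profile G) (τ : ℕ) :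
    Kernel (Hist S A τ) (S τ × A τ) :=
  Kernel.compProd (G.signal τ) (((β (G.N τ)).kernel τ rfl).comap
    (fun x : Hist S A τ × S τ => (histToPriv G.N S A τ x.1, x.2))
    (((measurable_histToPriv G.N S A τ).comp measurable_fst).prodMk measurable_snd))

instance (G : Game Player S A) (β : Profile G) (τ : ℕ) : IsMarkovKernel (stepKernel G β τ) := by
  unfold stepKernel; infer_instance

/-- The distribution on plays induced by a strategy profile (Ionescu-Tulcea). -/
def playLaw (G : Game Player S A) (β : Profile G) : Measure (Play S A) :=
  Kernel.trajMeasure (X := fun t => S t × A t) (stepKernel G β 0 (emptyHist S A))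
    (fun n => (stepKernel G β (n + 1)).comap (segToHist S A n) (measurable_segToHist S A n))

/-- `m` is the strategic measure of the strategy `β` of player `i`: for each period `τ` at which `i`
is active, the signal in `τ` is drawn from `μ τ` independently of the previous signals and actions
of `i`, and then the action is drawn according to `β`. (These conditions determine the joint law of
the first `k` pairs of coordinates recursively in `k`, hence `m`.) -/
def Strategy.Induces {G : Game Player S A} {i : Player} (β : Strategy G i)
    (m : ProbabilityMeasure (OwnPath G.N S A i)) : Prop :=
  ∀ τ (hτ : G.N τ = i),
    (m : Measure (OwnPath G.N S A i)).map
        (fun x => ((ownPast G.N S A hτ x, (x ⟨τ, hτ⟩).1), (x ⟨τ, hτ⟩).2)) =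
      Measure.compProd
        (((m : Measure (OwnPath G.N S A i)).map (ownPast G.N S A hτ)).prod (G.μ τ : Measure (S τ)))
        (β.kernel τ hτ)

/-- The set `M_i` of strategic measures of player `i`. -/
def strategicMeasures (G : Game Player S A) (i : Player) :
    Set (ProbabilityMeasure (OwnPath G.N S A i)) :=
  {m | ∃ β : Strategy G i, β.Induces m}

/-- Profiles of probability measures on the players' own paths. -/
abbrev MeasureProfile (G : Game Player S A) := ∀ i, ProbabilityMeasure (OwnPath G.N S A i)

/-- `P` is the distribution on plays that belongs to the profile `m` of strategic measures, i.e. the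
one induced by strategies whose strategic measures are the `m i`. -/
def HasPlayLaw (G : Game Player S A) (m : MeasureProfile G) (P : Measure (Play S A)) : Prop :=
  ∃ β : Profile G, (∀ i, (β i).Induces (m i)) ∧ playLaw G β = P

/-- The event that the play passes through an information set in `F`. -/
def reachEvent (G : Game Player S A) (τ : ℕ) (F : Set (Info G.N S A τ)) : Set (Play S A) :=
  playToInfo G.N S A τ ⁻¹' F

/-- `F` is reached with positive probability under the profile `m` of strategic measures. -/
def Reached (G : Game Player S A) (m : MeasureProfile G) (τ : ℕ) (F : Set (Info G.N S A τ)) :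
    Prop :=
  ∃ P, HasPlayLaw G m P ∧ 0 < P (reachEvent G τ F)

/-- `F` is strategically relevant at `τ` for the (proper) player active at `τ`. -/
structure Relevant (G : Game Player S A) (τ : ℕ) (F : Set (Info G.N S A τ)) : Prop where
  proper : τ ≠ 0
  measurable : MeasurableSet F
  reached : ∃ β : Profile G, 0 < playLaw G β (reachEvent G τ F)
  isOpen_section : ∀ (s : ∀ t : {t : ℕ // t < τ ∧ G.N t = G.N τ}, S t) (s' : S τ),
    IsOpen {a : ∀ t : {t : ℕ // t < τ ∧ G.N t = G.N τ}, A t | ((fun t => (s t, a t)), s') ∈ F}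

/-- `m'` is a `τ`-continuation of `m`. -/
def IsContinuation (G : Game Player S A) {i : Player} {τ : ℕ} (hτ : G.N τ = i)
    (m m' : ProbabilityMeasure (OwnPath G.N S A i)) : Prop :=
  m' ∈ strategicMeasures G i ∧
    (m' : Measure (OwnPath G.N S A i)).map (ownPast G.N S A hτ) =
      (m : Measure (OwnPath G.N S A i)).map (ownPast G.N S A hτ)

/-- The expected payoff of player `i` under `P` conditional on the event `E`. -/
def condPayoff (G : Game Player S A) (i : Player) (P : Measure (Play S A)) (E : Set (Play S A)) :
    ℝ :=
  ∫ p, G.payoff i p ∂(ProbabilityTheory.cond P E)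

open Classical in
/-- With `i` the player active at `τ`: `m_i` is `ε`-optimal at `F` against `m_{-i}`. -/
def EpsOptimal (G : Game Player S A) (m : MeasureProfile G) (τ : ℕ) (F : Set (Info G.N S A τ))
    (ε : ℝ) : Prop :=
  ∀ m' : ProbabilityMeasure (OwnPath G.N S A (G.N τ)), IsContinuation G rfl (m (G.N τ)) m' →
    ∀ P P' : Measure (Play S A), HasPlayLaw G m P →
      HasPlayLaw G (Function.update m (G.N τ) m') P' →
      condPayoff G (G.N τ) P' (reachEvent G τ F) - ε < condPayoff G (G.N τ) P (reachEvent G τ F)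

variable [∀ t, PolishSpace (S t)] [∀ t, BorelSpace (S t)]
  [∀ t, PolishSpace (A t)] [∀ t, BorelSpace (A t)]

/-- Sequential equilibria, as profiles of strategic measures; each `ProbabilityMeasure` carries the
weak topology, profiles carry the product topology. -/
def IsSequentialEquilibrium (G : Game Player S A) (m : MeasureProfile G) : Prop :=
  (∀ i, m i ∈ strategicMeasures G i) ∧
  ∃ u : ℕ → MeasureProfile G,
    (∀ n i, u n i ∈ strategicMeasures G i) ∧
    Tendsto u atTop (𝓝 m) ∧
    (∀ n τ (F : Set (Info G.N S A τ)), Relevant G τ F → Reached G (u n) τ F) ∧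
    ∀ ε : ℝ, 0 < ε → ∀ᶠ n in atTop,
      ∀ τ (F : Set (Info G.N S A τ)), Relevant G τ F → EpsOptimal G (u n) τ F ε

end SeqGame

end

/-! As soon as player `i` has a strategy at all, the strategic measures of `i` are exactly the
admissible ones, under which each own signal is independent of the player's past with law `μ τ` and
actions are almost surely feasible: a strategy is recovered by disintegration
(`mem_strategicMeasures_of_admissible`). Compactness of `M_i` thus reduces to Prokhorov's theorem
for admissible measures.

The obstacle is that the action correspondence is only measurable in the signals, whereas weak
convergence sees open sets. The remedy is that all admissible measures give the player's signals the
same law (`map_signals_eq_infinitePi`). Under a fixed law, a measurable set of signals can be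
enlarged to an open one at small cost, so feasibility survives weak limits
(`isClosed_admissibleMeasures`). Moreover, outside a small set of signals, compact sets of past
actions lead to a compact set of current actions, which gives tightness period by period
(`exists_isCompact_action_notMem_le`).

Equilibria form a closed subset of the product of these compact sets: an equilibrium is a limit of
profiles whose optimality defects vanish, and a diagonal sequence shows that a limit of equilibria
is again such a limit. -/

namespace SeqGame

/-! ### Correspondences measurable in one variable and continuous in the other -/

section Correspondence

universe u v

variable {Z : Type*} {Y : Type u} {B : Type v} [MeasurableSpace Z] [TopologicalSpace Y] [SecondCountableTopology Y]
  [TopologicalSpace B]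

/-- For a correspondence that is lower hemicontinuous in `y` and measurable in `z`, hitting an open
set somewhere over `K` is a measurable event, although it is an uncountable union of events. -/
theorem measurableSet_exists_mem_inter_nonempty {Φ : Z → Y → Set B}
    (hlow : ∀ z, LowerHemicontinuous (Φ z))
    (hmeas : ∀ y W, IsOpen W → MeasurableSet {z | (Φ z y ∩ W).Nonempty})
    (K : Set Y) {W : Set B} (hW : IsOpen W) :
    MeasurableSet {z | ∃ y ∈ K, (Φ z y ∩ W).Nonempty} := by
  obtain ⟨D, hDc, hDd⟩ := TopologicalSpace.exists_countable_dense K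
  have : {z | ∃ y ∈ K, (Φ z y ∩ W).Nonempty} = ⋃ y ∈ D, {z | (Φ z (y : Y) ∩ W).Nonempty} := by
    ext z
    simp only [Set.mem_ofPred_eq, Set.mem_iUnion, exists_prop]
    constructor
    · rintro ⟨y, hyK, hy⟩
      -- Lower hemicontinuity makes the set of good `y` open, so a countable dense subset of `K`
      -- already detects it.
      have ho : IsOpen {y : K | (Φ z (y : Y) ∩ W).Nonempty} :=
        (lowerHemicontinuous_iff_isOpen_inter_nonempty.1 (hlow z) W hW).preimage
          continuous_subtype_val
      obtain ⟨y', hy', hyD⟩ := hDd.inter_open_nonempty _ ho ⟨⟨y, hyK⟩, hy⟩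
      exact ⟨y', hyD, hy'⟩
    · rintro ⟨y, -, hy⟩
      exact ⟨y, y.2, hy⟩
  rw [this]
  exact MeasurableSet.biUnion hDc fun y _ => hmeas y W hW

/-- The complement of the graph of a correspondence that is measurable in `z` and continuous in `y`
is a countable union of products of a measurable set of `z`s and an open set of pairs `(y, b)`. -/
theorem exists_countable_cover_compl_graph [SecondCountableTopology B] [RegularSpace B]
    {Φ : Z → Y → Set B}
    (hlow : ∀ z, LowerHemicontinuous (Φ z)) (hup : ∀ z, UpperHemicontinuous (Φ z))
    (hclosed : ∀ z y, IsClosed (Φ z y))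
    (hmeas : ∀ y W, IsOpen W → MeasurableSet {z | (Φ z y ∩ W).Nonempty}) :
    ∃ (ι : Type (max u v)) (_ : Countable ι) (E : ι → Set Z) (O : ι → Set (Y × B)),
      (∀ n, MeasurableSet (E n)) ∧ (∀ n, IsOpen (O n)) ∧
      ∀ z y b, b ∉ Φ z y ↔ ∃ n, z ∈ E n ∧ (y, b) ∈ O n := by
  have hY := TopologicalSpace.isBasis_countableBasis Y
  have hB := TopologicalSpace.isBasis_countableBasis B
  refine ⟨TopologicalSpace.countableBasis Y × TopologicalSpace.countableBasis B, inferInstance,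
    fun n => {z | ∃ y ∈ (n.1 : Set Y), (Φ z y ∩ n.2).Nonempty}ᶜ,
    fun n => (n.1 : Set Y) ×ˢ (n.2 : Set B),
    fun n => (measurableSet_exists_mem_inter_nonempty hlow hmeas _ (hB.isOpen n.2.2)).compl,
    fun n => (hY.isOpen n.1.2).prod (hB.isOpen n.2.2), fun z y b => ⟨fun hb => ?_, ?_⟩⟩
  -- Regularity supplies a `W` whose closure misses the value at `y`; upper hemicontinuity then
  -- keeps nearby values off that closure.
  · obtain ⟨W, hW, hbW, hWsub⟩ := hB.exists_closure_subset ((hclosed z y).isOpen_compl.mem_nhds hb)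
    have hev : ∀ᶠ y' in 𝓝 y, Φ z y' ⊆ (closure W)ᶜ :=
      (hup z).forall_isOpen y _ isClosed_closure.isOpen_compl
        (Set.subset_compl_comm.1 hWsub)
    obtain ⟨V, hV, hyV, hVsub⟩ := hY.mem_nhds_iff.1 hev
    refine ⟨(⟨V, hV⟩, ⟨W, hW⟩), ?_, hyV, hbW⟩
    rintro ⟨y', hy', b', hb', hbW'⟩
    exact hVsub hy' hb' (subset_closure hbW')
  · rintro ⟨n, hz, hy, hb⟩ hmem
    exact hz ⟨y, hy, b, hmem, hb⟩

/-- Over a compact set of `y`s, a compact-valued correspondence that is measurable in `z` and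
continuous in `y` takes values in a single compact set, up to a small set of `z`s. -/
theorem exists_isCompact_forall_subset [TopologicalSpace.IsCompletelyMetrizableSpace B]
    [SecondCountableTopology B] {Φ : Z → Y → Set B}
    (hlow : ∀ z, LowerHemicontinuous (Φ z)) (hup : ∀ z, UpperHemicontinuous (Φ z))
    (hcompact : ∀ z y, IsCompact (Φ z y))
    (hmeas : ∀ y W, IsOpen W → MeasurableSet {z | (Φ z y ∩ W).Nonempty})
    (ν : Measure Z) [IsFiniteMeasure ν] {K : Set Y} (hK : IsCompact K)
    {ε : ENNReal} (hε : ε ≠ 0) :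
    ∃ C : Set B, IsCompact C ∧ ∃ T : Set Z, MeasurableSet T ∧ ν T ≤ ε ∧
      ∀ z ∉ T, ∀ y ∈ K, Φ z y ⊆ C := by
  rcases isEmpty_or_nonempty B with hB | hB
  · exact ⟨∅, isCompact_empty, ∅, .empty, by simp, fun z _ y _ b => (hB.false b).elim⟩
  let := TopologicalSpace.upgradeIsCompletelyMetrizable B
  let d := TopologicalSpace.denseSeq B
  obtain ⟨δ, hδ, hδsum⟩ := ENNReal.exists_pos_sum_of_countable' hε ℕ
  let r : ℕ → ℝ := fun k => 1 / ((k : ℝ) + 1)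
  have hr : ∀ k, 0 < r k := fun k => Nat.one_div_pos_of_nat
  let U : ℕ → ℕ → Set B := fun k J => ⋃ j ∈ Finset.range J, Metric.closedBall (d j) (r k)
  have hUclosed : ∀ k J, IsClosed (U k J) := fun k J =>
    isClosed_biUnion_finset fun j _ => Metric.isClosed_closedBall
  let T : ℕ → ℕ → Set Z := fun k J => {z | ∃ y ∈ K, (Φ z y ∩ (U k J)ᶜ).Nonempty}
  have hT : ∀ k J, MeasurableSet (T k J) := fun k J =>
    measurableSet_exists_mem_inter_nonempty hlow hmeas K (hUclosed k J).isOpen_compl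
  have hUmono : ∀ k, Monotone (U k) := fun k J J' h =>
    Set.biUnion_subset_biUnion_left fun j hj => Finset.range_mono h hj
  have hTanti : ∀ k, Antitone (T k) := fun k J J' h z ⟨y, hy, hne⟩ =>
    ⟨y, hy, hne.mono (Set.inter_subset_inter_right _ (Set.compl_subset_compl.2 (hUmono k h)))⟩
  -- For fixed `z`, each value is compact, hence inside finitely many open balls, and by upper
  -- hemicontinuity so are the nearby values. Compactness of `K` gives one `J` for all `y`, so no
  -- `z` stays bad for every `J`.
  have hTempty : ∀ k, ⋂ J, T k J = ∅ := by
    intro k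
    refine Set.eq_empty_of_forall_notMem fun z hz => ?_
    have key : ∀ y ∈ K, ∃ J, ∀ᶠ y' in 𝓝 y, Φ z y' ⊆ U k J := by
      intro y _
      have hcov : Φ z y ⊆ ⋃ j, Metric.ball (d j) (r k) := fun b _ => by
        obtain ⟨j, hj⟩ := (TopologicalSpace.denseRange_denseSeq B).exists_dist_lt b (hr k)
        exact Set.mem_iUnion.2 ⟨j, hj⟩
      obtain ⟨t, ht⟩ := (hcompact z y).elim_finite_subcover _ (fun j => Metric.isOpen_ball) hcov
      -- The successor is needed because `Finset.range J` stops before `J`.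
      refine ⟨t.sup id + 1, ?_⟩
      filter_upwards [(hup z).forall_isOpen y _
        (isOpen_biUnion fun j _ => Metric.isOpen_ball) ht] with y' hy'
      refine hy'.trans (Set.iUnion₂_subset fun j hj => ?_)
      refine Metric.ball_subset_closedBall.trans ?_
      exact Set.subset_biUnion_of_mem (u := fun j => Metric.closedBall (d j) (r k))
        (Finset.mem_coe.2 (Finset.mem_range.2 (Nat.lt_succ_of_le (Finset.le_sup (f := id) hj))))
    choose! J hJ using key
    obtain ⟨t, htK, ht⟩ := hK.elim_nhds_subcover (fun y => {y' | Φ z y' ⊆ U k (J y)}) hJ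
    obtain ⟨y, hyK, b, hb, hbU⟩ := Set.mem_iInter.1 hz (t.sup J)
    obtain ⟨y₀, hy₀, hy⟩ := Set.mem_iUnion₂.1 (ht hyK)
    exact hbU (hUmono k (Finset.le_sup hy₀) (hy hb))
  have hlim : ∀ k, ∃ J, ν (T k J) ≤ δ k := by
    intro k
    have := tendsto_measure_iInter_atTop (μ := ν) (fun J => (hT k J).nullMeasurableSet)
      (hTanti k) ⟨0, measure_ne_top _ _⟩
    rw [hTempty, measure_empty] at this
    exact ((ENNReal.tendsto_nhds_zero.1 this) (δ k) (hδ k)).exists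
  choose J hJ using hlim
  refine ⟨⋂ k, U k (J k), ?_, ⋃ k, T k (J k), MeasurableSet.iUnion fun k => hT k _, ?_, ?_⟩
  -- The intersection is closed in a complete space and has a finite net of every radius `r k`.
  · refine TotallyBounded.isCompact_of_isClosed ?_ (isClosed_iInter fun k => hUclosed k _)
    refine Metric.totallyBounded_iff.2 fun η hη => ?_
    obtain ⟨k, hk⟩ := exists_nat_one_div_lt hη
    refine ⟨d '' (Finset.range (J k) : Set ℕ), (Finset.finite_toSet _).image _, fun b hb => ?_⟩
    obtain ⟨j, hj, hbj⟩ := Set.mem_iUnion₂.1 (Set.mem_iInter.1 hb k)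
    exact Set.mem_iUnion₂.2 ⟨d j, ⟨j, hj, rfl⟩, lt_of_le_of_lt hbj hk⟩
  · exact (measure_iUnion_le _).trans ((ENNReal.tsum_le_tsum hJ).trans hδsum.le)
  · intro z hz y hy b hb
    refine Set.mem_iInter.2 fun k => ?_
    by_contra hbk
    exact hz (Set.mem_iUnion.2 ⟨k, y, hy, b, hb, hbk⟩)

end Correspondence

/-! ### Weak limits and tightness -/

section WeakLimits

/-- If the law of `q` is the same under all measures in `M`, then nullity of the intersection of an
open set with an event that is merely measurable in `q` is preserved under weak limits. -/
theorem measure_preimage_inter_eq_zero_of_mem_closure {X Z : Type*}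
    [TopologicalSpace X] [MeasurableSpace X] [BorelSpace X] [HasOuterApproxClosed X]
    [TopologicalSpace Z] [MeasurableSpace Z] [BorelSpace Z] {q : X → Z} (hq : Continuous q)
    (hqm : Measurable q)
    {ν : Measure Z} [IsFiniteMeasure ν] [ν.OuterRegular] {M : Set (ProbabilityMeasure X)}
    (hM : ∀ m ∈ M, (m : Measure X).map q = ν) {m : ProbabilityMeasure X} (hm : m ∈ closure M)
    {E : Set Z} (hE : MeasurableSet E) {O : Set X} (hO : IsOpen O)
    (h0 : ∀ m ∈ M, (m : Measure X) (q ⁻¹' E ∩ O) = 0) :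
    (m : Measure X) (q ⁻¹' E ∩ O) = 0 := by
  refine le_antisymm (ENNReal.le_of_forall_pos_le_add fun ε hε _ => ?_) zero_le
  rw [zero_add]
  -- The portmanteau inequality requires an open set. Replacing `E` by `V` costs `ν (V \ E)`, the
  -- same for every measure in `M`.
  obtain ⟨V, hEV, hVo, -, hV⟩ := hE.exists_isOpen_sdiff_lt (measure_ne_top ν E)
    (ENNReal.coe_ne_zero.2 hε.ne')
  have hne : (𝓝[M] m).NeBot := mem_closure_iff_nhdsWithin_neBot.1 hm
  have hlim : Tendsto id (𝓝[M] m) (𝓝 m) := nhdsWithin_le_nhds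
  calc (m : Measure X) (q ⁻¹' E ∩ O) ≤ (m : Measure X) (q ⁻¹' V ∩ O) := by gcongr
    _ ≤ (𝓝[M] m).liminf fun m' : ProbabilityMeasure X => (m' : Measure X) (q ⁻¹' V ∩ O) :=
      ProbabilityMeasure.le_liminf_measure_open_of_tendsto hlim ((hVo.preimage hq).inter hO)
    _ ≤ ε := by
      refine liminf_le_of_frequently_le' (Eventually.frequently ?_)
      filter_upwards [self_mem_nhdsWithin] with m' hm'
      have hsub : q ⁻¹' V ∩ O ⊆ (q ⁻¹' E ∩ O) ∪ q ⁻¹' (V \ E) := by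
        rintro x ⟨hxV, hxO⟩
        by_cases hx : q x ∈ E
        · exact Or.inl ⟨hx, hxO⟩
        · exact Or.inr ⟨hxV, hx⟩
      calc (m' : Measure X) (q ⁻¹' V ∩ O)
          ≤ (m' : Measure X) (q ⁻¹' E ∩ O) + (m' : Measure X) (q ⁻¹' (V \ E)) :=
            (measure_mono hsub).trans (measure_union_le _ _)
        _ = ν (V \ E) := by
            rw [h0 m' hm', zero_add, ← hM m' hm',
              Measure.map_apply hqm (hVo.measurableSet.diff hE)]
        _ ≤ ε := hV.le

/-- A set of measures on a countable product is tight if all its sets of marginals are tight. -/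
theorem isTightMeasureSet_pi {ι : Type*} [Countable ι] {X : ι → Type*}
    [∀ t, TopologicalSpace (X t)] [∀ t, MeasurableSpace (X t)] [∀ t, T2Space (X t)]
    {M : Set (Measure (∀ t, X t))}
    (h : ∀ t, ∀ ε : ENNReal, ε ≠ 0 → ∃ K : Set (X t), IsCompact K ∧
      ∀ m ∈ M, m {x | x t ∉ K} ≤ ε) : IsTightMeasureSet M := by
  rw [isTightMeasureSet_iff_exists_isCompact_measure_compl_le]
  intro ε hε
  obtain ⟨δ, hδ, hδsum⟩ := ENNReal.exists_pos_sum_of_countable' hε.ne' ι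
  choose K hK hKm using fun t => h t (δ t) (hδ t).ne'
  refine ⟨Set.univ.pi K, isCompact_univ_pi hK, fun m hm => ?_⟩
  have : (Set.univ.pi K)ᶜ ⊆ ⋃ t, {x : ∀ t, X t | x t ∉ K t} := by
    intro x hx
    simpa [Set.mem_pi] using hx
  exact (measure_mono this).trans ((measure_iUnion_le _).trans
    ((ENNReal.tsum_le_tsum fun t => hKm t m hm).trans hδsum.le))

end WeakLimits

/-! ### Own paths, signals and admissible measures -/

variable {Player : Type*} {S A : ℕ → Type*}
  [∀ t, TopologicalSpace (S t)] [∀ t, MeasurableSpace (S t)]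
  [∀ t, TopologicalSpace (A t)] [∀ t, MeasurableSpace (A t)]

/-- The information set at `τ` that an own path of the active player passes through. -/
def ownInfo {Player : Type*} (N : ℕ → Player) (S A : ℕ → Type*) {i : Player} {τ : ℕ}
    (hτ : N τ = i) (x : OwnPath N S A i) : Info N S A τ :=
  (ownPast N S A hτ x, (x ⟨τ, hτ⟩).1)

/-- The signals contained in an information set. -/
abbrev InfoSignals {Player : Type*} (N : ℕ → Player) (S : ℕ → Type*) (τ : ℕ) :=
  (∀ t : {t : ℕ // t < τ ∧ N t = N τ}, S t) × S τ

/-- The past actions contained in an information set. -/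
abbrev PastActions {Player : Type*} (N : ℕ → Player) (A : ℕ → Type*) (τ : ℕ) :=
  ∀ t : {t : ℕ // t < τ ∧ N t = N τ}, A t

/-- The signals up to `τ` of the player active at `τ`, in terms of all signals of that player. -/
def signalsUpTo {Player : Type*} (N : ℕ → Player) (S : ℕ → Type*) {i : Player} {τ : ℕ}
    (hτ : N τ = i) (s : ∀ t : {t : ℕ // N t = i}, S t) : InfoSignals N S τ :=
  (fun t => s ⟨t, t.2.2.trans hτ⟩, s ⟨τ, hτ⟩)

/-- The action correspondence as a function of the signals and the past actions. -/
def actionCorr (G : Game Player S A) (τ : ℕ) (z : InfoSignals G.N S τ) (a : PastActions G.N A τ) :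
    Set (A τ) :=
  G.actions τ (fun t => (z.1 t, a t), z.2)

/-- The measures on own paths under which signals are independent of the past with the underlying
laws, and actions are almost surely feasible. -/
def admissibleMeasures (G : Game Player S A) (i : Player) :
    Set (ProbabilityMeasure (OwnPath G.N S A i)) :=
  {m | ∀ τ (hτ : G.N τ = i),
    (m : Measure (OwnPath G.N S A i)).map (ownInfo G.N S A hτ) =
      ((m : Measure (OwnPath G.N S A i)).map (ownPast G.N S A hτ)).prod
        (G.μ τ : Measure (S τ)) ∧
    ∀ᵐ x ∂(m : Measure (OwnPath G.N S A i)), (x ⟨τ, hτ⟩).2 ∈ G.actions τ (ownInfo G.N S A hτ x)}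

section Basic

variable (G : Game Player S A) {i : Player} {τ : ℕ} (hτ : G.N τ = i)

theorem continuous_ownPast : Continuous (ownPast G.N S A hτ) :=
  continuous_pi fun _ => continuous_apply _

theorem continuous_ownInfo : Continuous (ownInfo G.N S A hτ) :=
  (continuous_ownPast G hτ).prodMk (continuous_fst.comp (continuous_apply _))

theorem continuous_signalsUpTo : Continuous (signalsUpTo G.N S hτ) :=
  (continuous_pi fun _ => continuous_apply _).prodMk (continuous_apply _)

theorem measurable_ownPast : Measurable (ownPast G.N S A hτ) :=
  measurable_pi_lambda _ fun _ => measurable_pi_apply _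

theorem measurable_ownInfo : Measurable (ownInfo G.N S A hτ) :=
  (measurable_ownPast G hτ).prodMk (measurable_fst.comp (measurable_pi_apply _))

theorem measurable_signalsUpTo : Measurable (signalsUpTo G.N S hτ) :=
  (measurable_pi_lambda _ fun _ => measurable_pi_apply _).prodMk (measurable_pi_apply _)

theorem measurable_signals : Measurable fun (x : OwnPath G.N S A i) t => (x t).1 :=
  measurable_pi_lambda _ fun t => measurable_fst.comp (measurable_pi_apply t)

theorem lowerHemicontinuous_actionCorr (z : InfoSignals G.N S τ) :
    LowerHemicontinuous (actionCorr G τ z) := G.actions_lower τ z.1 z.2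

theorem upperHemicontinuous_actionCorr (z : InfoSignals G.N S τ) :
    UpperHemicontinuous (actionCorr G τ z) := G.actions_upper τ z.1 z.2

theorem EpsOptimal.mono {G : Game Player S A} {m : MeasureProfile G} {τ : ℕ}
    {F : Set (Info G.N S A τ)} {ε ε' : ℝ} (h : EpsOptimal G m τ F ε) (hε : ε ≤ ε') :
    EpsOptimal G m τ F ε' := fun m' hm' P P' hP hP' =>
  (sub_le_sub_left hε _).trans_lt (h m' hm' P P' hP hP')

end Basic

/-! ### Strategic measures as admissible measures -/

section Polish

set_option linter.unusedSectionVars false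

variable [∀ t, PolishSpace (S t)] [∀ t, BorelSpace (S t)]
  [∀ t, PolishSpace (A t)] [∀ t, BorelSpace (A t)]
variable (G : Game Player S A) {i : Player}

/-- The game's measurability condition tests closed sets; an open set in a metrizable space is a
countable union of closed ones. -/
theorem measurableSet_actions_inter_nonempty (τ : ℕ) {W : Set (A τ)} (hW : IsOpen W) :
    MeasurableSet {x | (G.actions τ x ∩ W).Nonempty} := by
  let := TopologicalSpace.upgradeIsCompletelyMetrizable (A τ)
  obtain ⟨F, hF, -, hFW, -⟩ := hW.exists_iUnion_isClosed
  have : {x | (G.actions τ x ∩ W).Nonempty} = ⋃ n, {x | (G.actions τ x ∩ F n).Nonempty} := by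
    ext x
    simp only [Set.mem_ofPred_eq, Set.mem_iUnion, ← hFW, Set.inter_iUnion, Set.nonempty_iUnion]
  rw [this]
  exact MeasurableSet.iUnion fun n => G.actions_measurable τ _ (hF n)

theorem measurableSet_actionCorr_inter_nonempty (τ : ℕ) (a : PastActions G.N A τ) (W : Set (A τ))
    (hW : IsOpen W) : MeasurableSet {z | (actionCorr G τ z a ∩ W).Nonempty} := by
  have hm : Measurable fun z : InfoSignals G.N S τ =>
      (((fun t => (z.1 t, a t)), z.2) : Info G.N S A τ) :=
    (measurable_pi_lambda _ fun t =>
      ((measurable_pi_apply t).comp measurable_fst).prodMk measurable_const).prodMk measurable_snd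
  exact hm (measurableSet_actions_inter_nonempty G τ hW)

/-- The graph of the action correspondence is measurable. -/
theorem measurableSet_graph_actions (τ : ℕ) :
    MeasurableSet {p : Info G.N S A τ × A τ | p.2 ∈ G.actions τ p.1} := by
  have hB := TopologicalSpace.isBasis_countableBasis (A τ)
  have : {p : Info G.N S A τ × A τ | p.2 ∈ G.actions τ p.1}ᶜ =
      ⋃ W ∈ TopologicalSpace.countableBasis (A τ),
        {x | (G.actions τ x ∩ closure W).Nonempty}ᶜ ×ˢ W := by
    ext ⟨x, b⟩
    simp only [Set.mem_compl_iff, Set.mem_ofPred_eq, Set.mem_iUnion, Set.mem_prod, exists_prop]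
    constructor
    · intro hb
      obtain ⟨W, hW, hbW, hWsub⟩ := hB.exists_closure_subset
        ((G.actions_compact τ x).isClosed.isOpen_compl.mem_nhds hb)
      exact ⟨W, hW, fun ⟨b', hb', hbW'⟩ => hWsub hbW' hb', hbW⟩
    · rintro ⟨W, -, hne, hbW⟩ hb
      exact hne ⟨b, hb, subset_closure hbW⟩
  rw [← MeasurableSet.compl_iff, this]
  exact MeasurableSet.biUnion (TopologicalSpace.countable_countableBasis _) fun W hW =>
    (G.actions_measurable τ _ isClosed_closure).compl.prod (hB.isOpen hW).measurableSet

theorem Strategy.Induces.admissible {G : Game Player S A} {i : Player} {β : Strategy G i}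
    {m : ProbabilityMeasure (OwnPath G.N S A i)} (h : β.Induces m) :
    m ∈ admissibleMeasures G i := by
  intro τ hτ
  have hact : Measurable fun x : OwnPath G.N S A i => (x ⟨τ, hτ⟩).2 :=
    measurable_snd.comp (measurable_pi_apply _)
  have := Measure.isProbabilityMeasure_map (μ := (m : Measure (OwnPath G.N S A i)))
    (measurable_ownPast G hτ).aemeasurable
  have h' : (m : Measure (OwnPath G.N S A i)).map
      (fun x => (ownInfo G.N S A hτ x, (x ⟨τ, hτ⟩).2)) = _ := h τ hτ
  constructor
  · rw [← Measure.fst_map_prodMk hact, h', Measure.fst_compProd]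
  · have hae : ∀ᵐ p ∂((m : Measure (OwnPath G.N S A i)).map
        (fun x => (ownInfo G.N S A hτ x, (x ⟨τ, hτ⟩).2))), p.2 ∈ G.actions τ p.1 := by
      rw [h']
      refine Measure.ae_compProd_of_ae_ae (measurableSet_graph_actions G τ) (ae_of_all _ fun x => ?_)
      exact (prob_compl_eq_zero_iff (G.actions_compact τ x).isClosed.measurableSet).2
        (β.feasible τ hτ x)
    exact ae_of_ae_map ((measurable_ownInfo G hτ).prodMk hact).aemeasurable hae

/-- Admissible measures are strategic as soon as there is a strategy at all: disintegrate, and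
follow the given strategy where the disintegration is infeasible. -/
theorem mem_strategicMeasures_of_admissible {G : Game Player S A} {i : Player} (β : Strategy G i)
    {m : ProbabilityMeasure (OwnPath G.N S A i)} (hm : m ∈ admissibleMeasures G i) :
    m ∈ strategicMeasures G i := by
  classical
  have key : ∀ τ (hτ : G.N τ = i), ∃ κ : Kernel (Info G.N S A τ) (A τ), IsMarkovKernel κ ∧
      (∀ x, κ x (G.actions τ x) = 1) ∧
      (m : Measure (OwnPath G.N S A i)).map (fun x => (ownInfo G.N S A hτ x, (x ⟨τ, hτ⟩).2)) =
      Measure.compProd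
        (((m : Measure (OwnPath G.N S A i)).map (ownPast G.N S A hτ)).prod (G.μ τ : Measure (S τ)))
        κ := by
    intro τ hτ
    obtain ⟨x₀⟩ := (m : Measure (OwnPath G.N S A i)).nonempty_of_neZero
    have : Nonempty (A τ) := ⟨(x₀ ⟨τ, hτ⟩).2⟩
    have hact : Measurable fun x : OwnPath G.N S A i => (x ⟨τ, hτ⟩).2 :=
      measurable_snd.comp (measurable_pi_apply _)
    have hinfo := measurable_ownInfo G hτ
    let κ₀ := condDistrib (fun x : OwnPath G.N S A i => (x ⟨τ, hτ⟩).2) (ownInfo G.N S A hτ)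
      (m : Measure (OwnPath G.N S A i))
    have hκ₀ := compProd_map_condDistrib (mβ := inferInstance) (X := ownInfo G.N S A hτ)
      (μ := (m : Measure (OwnPath G.N S A i))) hact.aemeasurable
    have hT : MeasurableSet {x | κ₀ x (G.actions τ x) = 1} :=
      (Kernel.measurable_kernel_prodMk_left (κ := κ₀) (measurableSet_graph_actions G τ))
        (measurableSet_singleton 1)
    have hTae : ∀ᵐ x ∂(m : Measure (OwnPath G.N S A i)).map (ownInfo G.N S A hτ),
        κ₀ x (G.actions τ x) = 1 := by
      have hae : ∀ᵐ p ∂((m : Measure (OwnPath G.N S A i)).map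
          (fun x => (ownInfo G.N S A hτ x, (x ⟨τ, hτ⟩).2))), p.2 ∈ G.actions τ p.1 :=
        (ae_map_iff (hinfo.prodMk hact).aemeasurable (measurableSet_graph_actions G τ)).2
          (hm τ hτ).2
      rw [← hκ₀] at hae
      filter_upwards [Measure.ae_ae_of_ae_compProd hae] with x hx
      exact (prob_compl_eq_zero_iff (G.actions_compact τ x).isClosed.measurableSet).1 hx
    refine ⟨Kernel.piecewise hT κ₀ (β.kernel τ hτ), inferInstance, fun x => ?_, ?_⟩
    · rw [Kernel.piecewise_apply']
      split_ifs with hx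
      · exact hx
      · exact β.feasible τ hτ x
    -- By independence the product is the law of the information set, and the kernel was changed
    -- only on a null set for that law.
    · rw [← (hm τ hτ).1, ← hκ₀]
      refine Measure.compProd_congr ?_
      filter_upwards [hTae] with x hx
      rw [Kernel.piecewise_apply]
      exact (if_pos hx).symm
  choose κ hκ hfeas hκm using key
  exact ⟨⟨κ, hκ, hfeas⟩, hκm⟩

/-- The dichotomy avoids constructing a strategy by measurable selection: the empty set is compact
as well. -/
theorem strategicMeasures_eq_empty_or (i : Player) :
    strategicMeasures G i = ∅ ∨ strategicMeasures G i = admissibleMeasures G i := by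
  rcases Set.eq_empty_or_nonempty (strategicMeasures G i) with h | ⟨-, β, -⟩
  · exact Or.inl h
  · refine Or.inr (Set.Subset.antisymm ?_ fun m hm => mem_strategicMeasures_of_admissible β hm)
    rintro m ⟨β', hβ'⟩
    exact hβ'.admissible

/-! ### The common law of the signals -/

/-- The law of all signals of player `i` is the same under all admissible measures. -/
theorem map_signals_eq_infinitePi {m : ProbabilityMeasure (OwnPath G.N S A i)}
    (hm : ∀ τ (hτ : G.N τ = i), (m : Measure (OwnPath G.N S A i)).map (ownInfo G.N S A hτ) =
      ((m : Measure (OwnPath G.N S A i)).map (ownPast G.N S A hτ)).prod (G.μ τ : Measure (S τ))) :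
    (m : Measure (OwnPath G.N S A i)).map (fun x t => (x t).1) =
      Measure.infinitePi fun t : {t : ℕ // G.N t = i} => (G.μ t : Measure (S t)) := by
  classical
  refine Measure.eq_infinitePi _ fun s E hE => ?_
  rw [Measure.map_apply (measurable_signals G) (MeasurableSet.pi s.countable_toSet fun t _ => hE t)]
  -- Adding the latest period last places all other periods of `s` in its past, where the
  -- independence condition applies.
  induction s using Finset.induction_on_max with
  | empty => simp
  | insert τ s hlt ih =>
    rw [Finset.prod_insert fun h => lt_irrefl _ (hlt _ h), ← ih]
    obtain ⟨τ, hτ⟩ := τ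
    let D : Set (PrivHist G.N S A τ) :=
      {p | ∀ t (ht : t ∈ s), (p ⟨t, hlt t ht, t.2.trans hτ.symm⟩).1 ∈ E t}
    have hD : MeasurableSet D := by
      have : D = ⋂ t : s, (fun p : PrivHist G.N S A τ =>
          (p ⟨t, hlt t t.2, t.1.2.trans hτ.symm⟩).1) ⁻¹' E t := by
        ext p
        simp [D]
      rw [this]
      exact MeasurableSet.iInter fun t =>
        (measurable_fst.comp (measurable_pi_apply _)) (hE t)
    have h1 : (fun (x : OwnPath G.N S A i) t => (x t).1) ⁻¹'
        ((insert (⟨τ, hτ⟩ : {t : ℕ // G.N t = i}) s : Finset _) : Set _).pi E =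
        ownInfo G.N S A hτ ⁻¹' (D ×ˢ E ⟨τ, hτ⟩) := by
      ext x
      simp only [Set.mem_preimage, Set.mem_pi, Finset.coe_insert, Set.mem_insert_iff,
        Set.mem_prod, ownInfo, ownPast, D, Set.mem_ofPred_eq, forall_eq_or_imp, Finset.mem_coe]
      exact and_comm
    have h2 : (fun (x : OwnPath G.N S A i) t => (x t).1) ⁻¹' (s : Set _).pi E =
        ownPast G.N S A hτ ⁻¹' D := by
      ext x
      simp only [Set.mem_preimage, Set.mem_pi, ownPast, D, Set.mem_ofPred_eq, Finset.mem_coe]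
    rw [h1, h2, ← Measure.map_apply (measurable_ownInfo G hτ) (hD.prod (hE _)), hm τ hτ,
      Measure.prod_prod, Measure.map_apply (measurable_ownPast G hτ) hD, mul_comm]

/-- The law of the signals up to `τ` of the player active at `τ`, under admissible measures. -/
noncomputable def signalLaw (G : Game Player S A) {i : Player} {τ : ℕ} (hτ : G.N τ = i) :
    Measure (InfoSignals G.N S τ) :=
  (Measure.infinitePi fun t : {t : ℕ // G.N t = i} => (G.μ t : Measure (S t))).map
    (signalsUpTo G.N S hτ)

instance {τ : ℕ} (hτ : G.N τ = i) : IsProbabilityMeasure (signalLaw G hτ) :=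
  Measure.isProbabilityMeasure_map (measurable_signalsUpTo G hτ).aemeasurable

theorem map_signalsUpTo {m : ProbabilityMeasure (OwnPath G.N S A i)}
    (hm : ∀ τ (hτ : G.N τ = i), (m : Measure (OwnPath G.N S A i)).map (ownInfo G.N S A hτ) =
      ((m : Measure (OwnPath G.N S A i)).map (ownPast G.N S A hτ)).prod (G.μ τ : Measure (S τ)))
    {τ : ℕ} (hτ : G.N τ = i) :
    (m : Measure (OwnPath G.N S A i)).map (fun x => signalsUpTo G.N S hτ fun t => (x t).1) =
      signalLaw G hτ := by
  rw [signalLaw, ← map_signals_eq_infinitePi G hm, Measure.map_map (measurable_signalsUpTo G hτ) (measurable_signals G)]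
  rfl

/-! ### Compactness of the sets of strategic measures -/

/-- Independence equates two weakly continuous functions of the measure. Infeasibility is a
countable union of events, each measurable in the signals and open in the actions; each stays null
in the limit because the signal law is common. -/
theorem isClosed_admissibleMeasures (i : Player) : IsClosed (admissibleMeasures G i) := by
  refine isClosed_of_closure_subset fun m hm => ?_
  have hsig : ∀ τ (hτ : G.N τ = i), (m : Measure (OwnPath G.N S A i)).map (ownInfo G.N S A hτ) =
      ((m : Measure (OwnPath G.N S A i)).map (ownPast G.N S A hτ)).prod
        (G.μ τ : Measure (S τ)) := by
    intro τ hτ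
    have hc : IsClosed {m : ProbabilityMeasure (OwnPath G.N S A i) |
        m.map (continuous_ownInfo G hτ).measurable.aemeasurable =
          (m.map (continuous_ownPast G hτ).measurable.aemeasurable).prod (G.μ τ)} :=
      isClosed_eq (ProbabilityMeasure.continuous_map (continuous_ownInfo G hτ))
        (ProbabilityMeasure.continuous_prod.comp
          ((ProbabilityMeasure.continuous_map (continuous_ownPast G hτ)).prodMk continuous_const))
    have := closure_minimal (fun m' (hm' : m' ∈ admissibleMeasures G i) =>
      Subtype.ext (hm' τ hτ).1) hc hm
    exact congrArg Subtype.val this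
  refine fun τ hτ => ⟨hsig τ hτ, ?_⟩
  obtain ⟨ι, _, E, O, hE, hO, hEO⟩ := exists_countable_cover_compl_graph
    (lowerHemicontinuous_actionCorr G (τ := τ)) (upperHemicontinuous_actionCorr G)
    (fun z a => (G.actions_compact τ _).isClosed) (measurableSet_actionCorr_inter_nonempty G τ)
  let q : OwnPath G.N S A i → InfoSignals G.N S τ := fun x => signalsUpTo G.N S hτ fun t => (x t).1
  let y : OwnPath G.N S A i → PastActions G.N A τ × A τ :=
    fun x => (fun t => (x ⟨t, t.2.2.trans hτ⟩).2, (x ⟨τ, hτ⟩).2)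
  have hq : Continuous q := (continuous_signalsUpTo G hτ).comp
    (continuous_pi fun t => continuous_fst.comp (continuous_apply t))
  have hy : Continuous y := (continuous_pi fun t => continuous_snd.comp (continuous_apply _)).prodMk
    (continuous_snd.comp (continuous_apply _))
  have hcompl : {x : OwnPath G.N S A i | (x ⟨τ, hτ⟩).2 ∈ G.actions τ (ownInfo G.N S A hτ x)}ᶜ =
      ⋃ n, (q ⁻¹' E n ∩ y ⁻¹' O n) := by
    ext x
    rw [Set.mem_iUnion]
    exact hEO (q x) (y x).1 (y x).2
  rw [ae_iff, ← Set.compl_ofPred, hcompl, measure_iUnion_null_iff]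
  intro n
  refine measure_preimage_inter_eq_zero_of_mem_closure hq hq.measurable
    (fun m' hm' => map_signalsUpTo G (fun τ hτ => (hm' τ hτ).1) hτ) hm (hE n) ((hO n).preimage hy)
    fun m' hm' => ?_
  have h0 : (m' : Measure (OwnPath G.N S A i)) _ = 0 := ae_iff.1 (hm' τ hτ).2
  refine measure_mono_null (fun x hx => ?_) h0
  have := hcompl.ge (Set.mem_iUnion.2 ⟨n, hx⟩)
  exact this

/-- Up to small probability, the action in `τ` lies in a compact set that does not depend on the
admissible measure. -/
theorem exists_isCompact_action_notMem_le {τ : ℕ} (hτ : G.N τ = i) {ε : ENNReal} (hε : ε ≠ 0) :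
    ∃ K : Set (A τ), IsCompact K ∧ ∀ m ∈ admissibleMeasures G i,
      (m : Measure (OwnPath G.N S A i)) {x | (x ⟨τ, hτ⟩).2 ∉ K} ≤ ε := by
  induction τ using Nat.strong_induction_on generalizing ε with
  | _ τ ih =>
  have hε2 : ε / 2 ≠ 0 := (ENNReal.half_pos hε).ne'
  -- Half of `ε` is spread over the player's past actions leaving their compact sets; the other half
  -- pays for the exceptional signals `T`.
  obtain ⟨δ, hδ, hδsum⟩ :=
    ENNReal.exists_pos_sum_of_countable' hε2 {t : ℕ // t < τ ∧ G.N t = G.N τ}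
  choose K hK hKm using fun t : {t : ℕ // t < τ ∧ G.N t = G.N τ} =>
    ih t t.2.1 (t.2.2.trans hτ) (hδ t).ne'
  obtain ⟨C, hC, T, hT, hTε, hTC⟩ := exists_isCompact_forall_subset
    (lowerHemicontinuous_actionCorr G (τ := τ)) (upperHemicontinuous_actionCorr G)
    (fun z a => G.actions_compact τ _) (measurableSet_actionCorr_inter_nonempty G τ)
    (signalLaw G hτ) (isCompact_univ_pi hK) hε2
  refine ⟨C, hC, fun m hm => ?_⟩
  let q : OwnPath G.N S A i → InfoSignals G.N S τ := fun x => signalsUpTo G.N S hτ fun t => (x t).1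
  have hq : Measurable q := (measurable_signalsUpTo G hτ).comp (measurable_signals G)
  have hsub : {x : OwnPath G.N S A i | (x ⟨τ, hτ⟩).2 ∉ C} ⊆
      ({x | ¬ (x ⟨τ, hτ⟩).2 ∈ G.actions τ (ownInfo G.N S A hτ x)} ∪ q ⁻¹' T) ∪
        ⋃ t, {x | (x ⟨t, t.2.2.trans hτ⟩).2 ∉ K t} := by
    intro x hx
    by_contra hcon
    simp only [Set.mem_union, Set.mem_iUnion, Set.mem_ofPred_eq, not_or, not_not, not_exists]
      at hcon
    exact hx (hTC (q x) hcon.1.2 (fun t => (x ⟨t, t.2.2.trans hτ⟩).2) (fun t _ => hcon.2 t)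
      hcon.1.1)
  have h0 : (m : Measure (OwnPath G.N S A i))
      {x | ¬ (x ⟨τ, hτ⟩).2 ∈ G.actions τ (ownInfo G.N S A hτ x)} = 0 := ae_iff.1 (hm τ hτ).2
  calc (m : Measure (OwnPath G.N S A i)) {x | (x ⟨τ, hτ⟩).2 ∉ C}
      ≤ (0 + ε / 2) + ε / 2 := by
        refine (measure_mono hsub).trans ((measure_union_le _ _).trans (add_le_add
          ((measure_union_le _ _).trans (add_le_add h0.le ?_)) ?_))
        · rw [← Measure.map_apply hq hT, map_signalsUpTo G (fun τ hτ => (hm τ hτ).1) hτ]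
          exact hTε
        · exact (measure_iUnion_le _).trans
            ((ENNReal.tsum_le_tsum fun t => hKm t m hm).trans hδsum.le)
    _ = ε := by rw [zero_add, ENNReal.add_halves]

/-- The signal has one law under all admissible measures, and a single law on a Polish space is
tight. -/
theorem exists_isCompact_signal_notMem_le {τ : ℕ} (hτ : G.N τ = i) {ε : ENNReal} (hε : ε ≠ 0) :
    ∃ K : Set (S τ), IsCompact K ∧ ∀ m ∈ admissibleMeasures G i,
      (m : Measure (OwnPath G.N S A i)) {x | (x ⟨τ, hτ⟩).1 ∉ K} ≤ ε := by
  obtain ⟨K, hK, hKε⟩ := isTightMeasureSet_iff_exists_isCompact_measure_compl_le.1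
    (isTightMeasureSet_singleton (μ := (signalLaw G hτ).map Prod.snd)) ε (pos_iff_ne_zero.2 hε)
  refine ⟨K, hK, fun m hm => ?_⟩
  have := hKε _ rfl
  have hq : Measurable fun x : OwnPath G.N S A i => signalsUpTo G.N S hτ fun t => (x t).1 :=
    (measurable_signalsUpTo G hτ).comp (measurable_signals G)
  rw [← map_signalsUpTo G (fun τ hτ => (hm τ hτ).1) hτ, Measure.map_map measurable_snd hq,
    Measure.map_apply (measurable_snd.comp hq) hK.measurableSet.compl] at this
  exact this

theorem isCompact_admissibleMeasures (i : Player) : IsCompact (admissibleMeasures G i) := by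
  rw [← (isClosed_admissibleMeasures G i).closure_eq]
  refine isCompact_closure_of_isTightMeasureSet (isTightMeasureSet_pi fun t ε hε => ?_)
  have hε2 : ε / 2 ≠ 0 := (ENNReal.half_pos hε).ne'
  obtain ⟨K, hK, hKm⟩ := exists_isCompact_signal_notMem_le G t.2 hε2
  obtain ⟨C, hC, hCm⟩ := exists_isCompact_action_notMem_le G t.2 hε2
  refine ⟨K ×ˢ C, hK.prod hC, ?_⟩
  rintro _ ⟨m, hm, rfl⟩
  have hsub : {x : OwnPath G.N S A i | x t ∉ K ×ˢ C} ⊆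
      {x | (x t).1 ∉ K} ∪ {x | (x t).2 ∉ C} := by
    intro x hx
    by_contra hcon
    simp only [Set.mem_union, Set.mem_ofPred_eq, not_or, not_not] at hcon
    exact hx hcon
  exact (measure_mono hsub).trans ((measure_union_le _ _).trans
    ((add_le_add (hKm m hm) (hCm m hm)).trans_eq (ENNReal.add_halves ε)))

theorem isCompact_strategicMeasures (i : Player) : IsCompact (strategicMeasures G i) := by
  rcases strategicMeasures_eq_empty_or G i with h | h <;> rw [h]
  · exact isCompact_empty
  · exact isCompact_admissibleMeasures G i

/-! ### Closedness of the set of sequential equilibria -/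

theorem isClosed_setOf_isSequentialEquilibrium :
    IsClosed {m : MeasureProfile G | IsSequentialEquilibrium G m} := by
  -- Countably many players make the product topology first countable, so that a sequence can reach
  -- `m`.
  have : Countable Player := G.N_surjective.countable
  refine isClosed_of_closure_subset fun m hm => ⟨fun i => ?_, ?_⟩
  · have hc : IsClosed {m : MeasureProfile G | m i ∈ strategicMeasures G i} :=
      (isCompact_strategicMeasures G i).isClosed.preimage (continuous_apply i)
    exact closure_minimal (fun m' (hm' : IsSequentialEquilibrium G m') => hm'.1 i) hc hm
  · obtain ⟨U, hU⟩ := (𝓝 m).exists_antitone_basis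
    have key : ∀ k : ℕ, ∃ w : MeasureProfile G, w ∈ U k ∧ (∀ i, w i ∈ strategicMeasures G i) ∧
        (∀ τ (F : Set (Info G.N S A τ)), Relevant G τ F → Reached G w τ F) ∧
        ∀ τ (F : Set (Info G.N S A τ)), Relevant G τ F →
          EpsOptimal G w τ F (1 / ((k : ℝ) + 1)) := by
      intro k
      obtain ⟨V, hVU, hVo, hmV⟩ := mem_nhds_iff.1 (hU.mem k)
      obtain ⟨m', hm'V, -, u, hu, hlim, hreach, hopt⟩ := mem_closure_iff.1 hm V hVo hmV
      -- Optimality is asked of the approximating profiles, not of the limit, so the `k`th diagonal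
      -- term is taken from the sequence of an equilibrium in `V`, with tolerance `1 / (k + 1)`.
      obtain ⟨n, hnV, hn⟩ := ((hlim.eventually (hVo.mem_nhds hm'V)).and
        (hopt (1 / ((k : ℝ) + 1)) Nat.one_div_pos_of_nat)).exists
      exact ⟨u n, hVU hnV, hu n, hreach n, hn⟩
    choose w hwU hws hwr hwo using key
    refine ⟨w, hws, hU.tendsto hwU, hwr, fun ε hε => ?_⟩
    obtain ⟨k, hk⟩ := exists_nat_one_div_lt hε
    filter_upwards [eventually_ge_atTop k] with n hn τ F hF
    exact (hwo n τ F hF).mono ((Nat.one_div_le_one_div hn).trans hk.le)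

end Polish

end SeqGame

theorem mainTheorem2 {Player : Type*} {S A : ℕ → Type*}
    [∀ t, TopologicalSpace (S t)] [∀ t, PolishSpace (S t)]
    [∀ t, MeasurableSpace (S t)] [∀ t, BorelSpace (S t)]
    [∀ t, TopologicalSpace (A t)] [∀ t, PolishSpace (A t)]
    [∀ t, MeasurableSpace (A t)] [∀ t, BorelSpace (A t)]
    (G : SeqGame.Game Player S A) :
    IsCompact {m : SeqGame.MeasureProfile G | SeqGame.IsSequentialEquilibrium G m} :=
  (isCompact_univ_pi fun i => SeqGame.isCompact_strategicMeasures G i).of_isClosed_subset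
    (SeqGame.isClosed_setOf_isSequentialEquilibrium G) fun _ hm i _ => hm.1 i
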